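/- Let $G$ be a word-hyperbolic group with Gromov boundary $\partial G$. Suppose $G$ acts by homeomorphisms on a compact metrizable space $Z$ as a convergence group: for every sequence $(g_n)$ of distinct elements of $G$ there are $a,b\in Z$ and a subsequence $(g_{n_k})$ such that $g_{n_k}|_{Z\setminus\{a\}}$ converges, uniformly on compact subsets, to the constant map with value $b$. Suppose that this action is non-elementary, i.e. $G$ is infinite and preserves no nonempty subset of $Z$ with at most two points. Let $i:\partial G\to Z$ be a Cannon–Thurston map, i.e. a continuous $G$-equivariant map, and put $L_i=\{(x,y)\in\partial G\times\partial G : i(x)=i(y),\ x\neq y\}$. For $X\in\{Z,\partial G\}$ and $x\in X$, a *conical sequence* for $x$ with *pole pair* $(x_-,x_+)$ is a sequence $(g_n)$ of distinct elements of $G$, with $x_-\ne x_+$ points of $X$, such that $g_nx\to x_+$ and $g_n|_{X\setminus\{x\}}$ converges, uniformly on compact subsets, to the constant map with value $x_-$. A point of $Z$ is a *conical limit point* if it has a conical sequence. A point $x\in\partial G$ is *asymptotic to $L_i$* if for every conical sequence for $x$ its pole pair $(x_-,x_+)$ lies in $L_i$, i.e. $i(x_-)=i(x_+)$. Let $z\in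 i(\partial G)$. Then: (1) $z$ is not a conical limit point for the action of $G$ on $Z$ if and only if some $x\in i^{-1}(z)$ is asymptotic to $L_i$. (2) If $|i^{-1}(z)|>1$, then every $x\in i^{-1}(z)$ is asymptotic to $L_i$, and hence $z$ is not a conical limit point. -/

import Mathlib

open Filter Topology Set

section HyperbolicGroups

variable {G : Type*} [Group G]

/-- A walk in a graph is geodesic if its length is the distance between its endpoints. -/
def IsGeodesicWalk {V : Type*} {Γ : SimpleGraph V} {u v : V} (p : Γ.Walk u v) : Prop :=
  (p.length : ℕ∞) = Γ.edist u v

/-- A graph is hyperbolic if it is connected and, for some `δ`, each side of every geodesic triangle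
is contained in the `δ`-neighbourhood of the union of the two other sides. (Vertices of the triangle
are arbitrary vertices of the graph, so it suffices to put the condition on one of the sides.) -/
def IsHyperbolicGraph {V : Type*} (Γ : SimpleGraph V) : Prop :=
  Γ.Connected ∧ ∃ δ : ℕ, ∀ (x y z : V) (p : Γ.Walk x y) (q : Γ.Walk y z) (r : Γ.Walk x z),
    IsGeodesicWalk p → IsGeodesicWalk q → IsGeodesicWalk r →
      ∀ v ∈ r.support, ∃ w, (w ∈ p.support ∨ w ∈ q.support) ∧ Γ.edist v w ≤ δ

/-- `S` is a finite generating set of the group `G` whose Cayley graph is hyperbolic. -/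
structure IsHyperbolicGeneratingSet (S : Set G) : Prop where
  finite : S.Finite
  closure_eq_top : Subgroup.closure S = ⊤
  hyperbolic : IsHyperbolicGraph (SimpleGraph.mulCayley S)

/-- Left multiplication is isometric for the word metric. -/
theorem mulCayley_edist_mul_left (S : Set G) (g u v : G) :
    (SimpleGraph.mulCayley S).edist (g * u) (g * v) = (SimpleGraph.mulCayley S).edist u v := by
  have key : ∀ g u v : G, (SimpleGraph.mulCayley S).edist (g * u) (g * v) ≤
      (SimpleGraph.mulCayley S).edist u v := by
    intro g u v
    let f : SimpleGraph.mulCayley S →g SimpleGraph.mulCayley S :=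
      ⟨fun x => g * x, fun h => SimpleGraph.mulCayley_adj_mul_iff_right.2 h⟩
    by_cases h : (SimpleGraph.mulCayley S).edist u v = ⊤
    · rw [h]; exact le_top
    · obtain ⟨p, hp⟩ := SimpleGraph.exists_walk_of_edist_ne_top h
      rw [← hp]
      have := SimpleGraph.edist_le (p.map f)
      rwa [SimpleGraph.Walk.length_map] at this
  refine le_antisymm (key g u v) ?_
  simpa using key g⁻¹ (g * u) (g * v)

/-- The geodesic rays in the Cayley graph of `G` with respect to `S`, starting at any vertex. -/
def GeodesicRay (S : Set G) : Type _ :=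
  {ρ : ℕ → G // ∀ m k : ℕ, (SimpleGraph.mulCayley S).edist (ρ m) (ρ (m + k)) = k}

/-- The topology of pointwise convergence (equivalently, of uniform convergence on compact sets)
on geodesic rays, where the vertex set `G` is discrete. -/
instance (S : Set G) : TopologicalSpace (GeodesicRay S) :=
  TopologicalSpace.induced (fun ρ => ρ.1) (@Pi.topologicalSpace ℕ (fun _ => G) (fun _ => ⊥))

/-- Two geodesic rays are asymptotic if they stay at bounded distance from each other. -/
instance asymptoticSetoid (S : Set G) : Setoid (GeodesicRay S) where
  r ρ σ := ∃ C : ℕ, ∀ n : ℕ, (SimpleGraph.mulCayley S).edist (ρ.1 n) (σ.1 n) ≤ C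
  iseqv :=
    { refl := fun ρ => ⟨0, fun n => by simp⟩
      symm := fun {ρ σ} ⟨C, hC⟩ => ⟨C, fun n => by
        rw [SimpleGraph.edist_comm]; exact hC n⟩
      trans := fun {ρ σ τ} ⟨C, hC⟩ ⟨D, hD⟩ => ⟨C + D, fun n => by
        push_cast
        exact SimpleGraph.edist_triangle.trans (add_le_add (hC n) (hD n))⟩ }

/-- The Gromov boundary `∂G`: asymptotic classes of geodesic rays in the Cayley graph. -/
def GromovBoundary (S : Set G) : Type _ := Quotient (asymptoticSetoid S)

/-- The boundary carries the quotient topology. -/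
instance (S : Set G) : TopologicalSpace (GromovBoundary S) :=
  inferInstanceAs (TopologicalSpace (Quotient (asymptoticSetoid S)))

/-- `G` acts on geodesic rays by left translation. -/
instance (S : Set G) : MulAction G (GeodesicRay S) where
  smul g ρ := ⟨fun n => g * ρ.1 n, fun m k => by
    rw [mulCayley_edist_mul_left]; exact ρ.2 m k⟩
  one_smul ρ := Subtype.ext (funext fun n => one_mul (ρ.1 n))
  mul_smul g h ρ := Subtype.ext (funext fun n => mul_assoc g h (ρ.1 n))

/-- The induced action of `G` on its Gromov boundary. -/
instance (S : Set G) : MulAction G (GromovBoundary S) where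
  smul g := Quotient.map (fun ρ : GeodesicRay S => g • ρ) (fun ρ σ ⟨C, hC⟩ => ⟨C, fun n =>
    (mulCayley_edist_mul_left S g (ρ.1 n) (σ.1 n)).trans_le (hC n)⟩)
  one_smul x := Quotient.inductionOn x fun ρ =>
    congrArg (Quotient.mk (asymptoticSetoid S)) (one_smul G ρ)
  mul_smul g h x := Quotient.inductionOn x fun ρ =>
    congrArg (Quotient.mk (asymptoticSetoid S)) (mul_smul g h ρ)

end HyperbolicGroups

section ConvergenceGroups

variable {G : Type*} [Group G] {X : Type*} [TopologicalSpace X] [MulAction G X]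

/-- The maps `g n`, restricted to `X \ {a}`, converge uniformly on compact subsets to the constant
map with value `b`. (Uniform convergence on `K` to a constant `b` says that every neighbourhood of
`b` contains `g n • K` for all large `n`.) -/
def ConvergesToConstOff (g : ℕ → G) (a b : X) : Prop :=
  ∀ K : Set X, IsCompact K → K ⊆ {a}ᶜ → ∀ U ∈ 𝓝 b, ∀ᶠ n in atTop, ∀ y ∈ K, g n • y ∈ U

variable (G X) in
/-- Every sequence of distinct elements of `G` has a convergence subsequence. -/
def IsConvergenceAction : Prop :=
  ∀ g : ℕ → G, Function.Injective g →
    ∃ (a b : X) (φ : ℕ → ℕ), StrictMono φ ∧ ConvergesToConstOff (fun k => g (φ k)) a b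

variable (G X) in
/-- The action is elementary if `G` is finite or preserves a nonempty subset of at most two
points. -/
def IsElementaryAction : Prop :=
  Finite G ∨ ∃ A : Set X, A.Nonempty ∧ A.encard ≤ 2 ∧ ∀ g : G, (fun y => g • y) '' A = A

/-- `g` is a conical sequence for `z` with pole pair `(zm, zp)`. -/
structure IsConicalSequence (g : ℕ → G) (z zm zp : X) : Prop where
  injective : Function.Injective g
  ne : zm ≠ zp
  tendsto : Tendsto (fun n => g n • z) atTop (𝓝 zp)
  converges : ConvergesToConstOff g z zm

variable (G) in
/-- `z` is a conical limit point for the action of `G`. -/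
def IsConicalLimitPoint (z : X) : Prop :=
  ∃ (g : ℕ → G) (zm zp : X), IsConicalSequence g z zm zp

end ConvergenceGroups

section CannonThurston

variable {G : Type*} [Group G] {S : Set G} {Z : Type*}

/-- A Cannon–Thurston map `∂G → Z` is a continuous `G`-equivariant map. -/
structure IsCannonThurstonMap [TopologicalSpace Z] [MulAction G Z]
    (i : GromovBoundary S → Z) : Prop where
  continuous : Continuous i
  equivariant : ∀ (g : G) (x : GromovBoundary S), i (g • x) = g • i x

/-- The lamination `L_i` of pairs of distinct points of `∂G` identified by `i`. -/
def laminationOf (i : GromovBoundary S → Z) : Set (GromovBoundary S × GromovBoundary S) :=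
  {p | i p.1 = i p.2 ∧ p.1 ≠ p.2}

/-- `x` is asymptotic to `L` if every conical sequence for `x` has its pole pair in `L`. -/
def IsAsymptoticTo (x : GromovBoundary S) (L : Set (GromovBoundary S × GromovBoundary S)) : Prop :=
  ∀ (g : ℕ → G) (xm xp : GromovBoundary S), IsConicalSequence g x xm xp → (xm, xp) ∈ L

end CannonThurston

/-! The theorem compares convergence sequences on `∂G` and on `Z`. If `g` converges off `a` to `b`
on `∂G`, then on `Z` it converges off `i a` to `i b`. `ConvergesToConstOff.eq_map` shows that no
other pair of points is possible, using that the range of `i` is invariant and so has at least three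
points; `ConvergesToConstOff.map` deduces convergence from the convergence property of `Z`. Hence a
conical sequence for `x` whose poles `i` separates is conical for `i x`. Conversely, the convergence
property of `∂G` and sequential compactness lift a conical sequence for `i x` to one for `x` with
separated poles (`IsConicalLimitPoint.exists_lift`). This gives (1). In (2), a second point `y` of
the fibre has `g n • y → xm` while `g n • x → xp`, and `i` identifies the two orbits, so `i xm = i
xp`. The geometric input is `isConvergenceAction`, proved by thin triangles and limits of geodesics.
Limits are compared only after applying `i`, in the Hausdorff space `Z`. -/

/-! ### Thin geodesic polygons in a hyperbolic graph. -/

section ThinPolygons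

variable {V : Type*} {Γ : SimpleGraph V}

/-- The vertices `p 0, …, p M` are the consecutive vertices of a geodesic. -/
def IsGeodesicSegment (Γ : SimpleGraph V) (p : ℕ → V) (M : ℕ) : Prop :=
  ∀ i k, i + k ≤ M → Γ.dist (p i) (p (i + k)) = k

/-- Geodesic triangles, with sides parametrized by natural numbers, are `δ`-thin. -/
def HasThinTriangles (Γ : SimpleGraph V) (δ : ℕ) : Prop :=
  ∀ (p q r : ℕ → V) (A B L : ℕ), IsGeodesicSegment Γ p A → IsGeodesicSegment Γ q B →
    IsGeodesicSegment Γ r L → r 0 = p 0 → p A = q 0 → r L = q B → ∀ i ≤ L,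
      (∃ j ≤ A, Γ.dist (r i) (p j) ≤ δ) ∨ ∃ j ≤ B, Γ.dist (r i) (q j) ≤ δ

namespace IsGeodesicSegment

variable {p : ℕ → V} {M : ℕ}

theorem dist_eq (hp : IsGeodesicSegment Γ p M) {i j : ℕ} (hij : i ≤ j) (hj : j ≤ M) :
    Γ.dist (p i) (p j) = j - i := by
  obtain ⟨k, rfl⟩ := Nat.exists_eq_add_of_le hij
  rw [hp i k hj]; omega

theorem mono (hp : IsGeodesicSegment Γ p M) {N : ℕ} (h : N ≤ M) : IsGeodesicSegment Γ p N :=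
  fun i k hik => hp i k (hik.trans h)

theorem reverse (hp : IsGeodesicSegment Γ p M) : IsGeodesicSegment Γ (fun j => p (M - j)) M := by
  intro i k hik
  rw [SimpleGraph.dist_comm, hp.dist_eq (by omega) (by omega)]
  omega

theorem exists_walk (hp : IsGeodesicSegment Γ p M) :
    ∃ w : Γ.Walk (p 0) (p M), w.length = M ∧ ∀ v, v ∈ w.support ↔ ∃ i ≤ M, p i = v := by
  induction M with
  | zero => exact ⟨.nil, rfl, fun v => by simp [eq_comm]⟩
  | succ M ih =>
    obtain ⟨w, hw, hs⟩ := ih (hp.mono M.le_succ)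
    refine ⟨w.concat (SimpleGraph.dist_eq_one_iff_adj.1 (hp M 1 le_rfl)), by simp [hw], fun v => ?_⟩
    rw [SimpleGraph.Walk.support_concat, List.mem_append, hs,
      List.mem_singleton]
    constructor
    · rintro (⟨i, hi, rfl⟩ | rfl)
      · exact ⟨i, by omega, rfl⟩
      · exact ⟨M + 1, le_rfl, rfl⟩
    · rintro ⟨i, hi, rfl⟩
      rcases Nat.lt_or_ge M i with h | h
      · exact Or.inr (by rw [show i = M + 1 by omega])
      · exact Or.inl ⟨i, h, rfl⟩

end IsGeodesicSegment

theorem IsHyperbolicGraph.exists_hasThinTriangles (h : IsHyperbolicGraph Γ) :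
    ∃ δ, HasThinTriangles Γ δ := by
  obtain ⟨hc, δ, hδ⟩ := h
  refine ⟨δ, fun p q r A B L hp hq hr h0 h1 h2 i hi => ?_⟩
  have geod : ∀ {s : ℕ → V} {M : ℕ} {w : Γ.Walk (s 0) (s M)}, IsGeodesicSegment Γ s M →
      w.length = M → IsGeodesicWalk w := by
    intro s M w hs hw
    have := hs.dist_eq (Nat.zero_le M) le_rfl
    rw [IsGeodesicWalk, hw, ← (hc (s 0) (s M)).coe_dist_eq_edist, this, Nat.sub_zero]
  obtain ⟨wp, lp, sp⟩ := hp.exists_walk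
  obtain ⟨wq, lq, sq⟩ := hq.exists_walk
  obtain ⟨wr, lr, sr⟩ := hr.exists_walk
  obtain ⟨w, hw, hd⟩ := hδ _ _ _ (wp.copy h0.symm h1) wq (wr.copy rfl h2)
    (by rw [IsGeodesicWalk, SimpleGraph.Walk.length_copy, h0, ← h1]; exact geod hp lp) (geod hq lq)
    (by rw [IsGeodesicWalk, SimpleGraph.Walk.length_copy, ← h2]; exact geod hr lr)
    (r i) (by rw [SimpleGraph.Walk.support_copy, sr]; exact ⟨i, hi, rfl⟩)
  rw [SimpleGraph.Walk.support_copy, sp, sq] at hw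
  rw [← (hc (r i) w).coe_dist_eq_edist, Nat.cast_le] at hd
  rcases hw with ⟨j, hj, rfl⟩ | ⟨j, hj, rfl⟩
  · exact Or.inl ⟨j, hj, hd⟩
  · exact Or.inr ⟨j, hj, hd⟩

/-- The last clause also covers `k` past the endpoint, where `p` stays constant. It places a whole
sequence of such `p` in one product of balls, for compactness arguments. -/
theorem SimpleGraph.Connected.exists_isGeodesicSegment (hc : Γ.Connected) (u v : V) :
    ∃ p : ℕ → V, p 0 = u ∧ p (Γ.dist u v) = v ∧ IsGeodesicSegment Γ p (Γ.dist u v) ∧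
      ∀ k, Γ.dist u (p k) ≤ k := by
  obtain ⟨w, hw⟩ := hc.exists_walk_length_eq_dist u v
  have h1 : ∀ i, Γ.dist (w.getVert i) (w.getVert (i + 1)) ≤ 1 := by
    intro i
    rcases Nat.lt_or_ge i w.length with h | h
    · exact (SimpleGraph.dist_eq_one_iff_adj.2 (w.adj_getVert_succ h)).le
    · rw [w.getVert_of_length_le h, w.getVert_of_length_le (h.trans (Nat.le_succ i))]
      simp
  have h2 : ∀ i k, Γ.dist (w.getVert i) (w.getVert (i + k)) ≤ k := by
    intro i k
    induction k with
    | zero => simp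
    | succ k ih =>
      have := hc.dist_triangle (u := w.getVert i) (v := w.getVert (i + k))
        (w := w.getVert (i + (k + 1)))
      have := h1 (i + k)
      rw [add_assoc] at this
      omega
  have hl : w.getVert (Γ.dist u v) = v := hw ▸ w.getVert_length
  refine ⟨w.getVert, w.getVert_zero, hl, fun i k hik => ?_, fun k => ?_⟩
  · have a := h2 i k
    have b := h2 0 i
    have c := h2 (i + k) (Γ.dist u v - (i + k))
    rw [Nat.add_sub_cancel' hik, hl] at c
    rw [zero_add, w.getVert_zero] at b
    have d := hc.dist_triangle (u := u) (v := w.getVert i) (w := v)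
    have e := hc.dist_triangle (u := w.getVert i) (v := w.getVert (i + k)) (w := v)
    omega
  · have := h2 0 k
    rwa [zero_add, w.getVert_zero] at this

variable {δ : ℕ}

/-- A side of a geodesic quadrilateral is contained in the `2δ`-neighbourhood of the others. -/
theorem HasThinTriangles.quadrilateral (hδ : HasThinTriangles Γ δ) (hc : Γ.Connected)
    {p s t u : ℕ → V} {L A B C : ℕ} (hp : IsGeodesicSegment Γ p L) (hs : IsGeodesicSegment Γ s A)
    (ht : IsGeodesicSegment Γ t B) (hu : IsGeodesicSegment Γ u C) (h0 : s 0 = p 0)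
    (h1 : t 0 = p L) (h2 : u 0 = s A) (h3 : u C = t B) {i : ℕ} (hi : i ≤ L) :
    (∃ j ≤ A, Γ.dist (p i) (s j) ≤ 2 * δ) ∨ (∃ j ≤ B, Γ.dist (p i) (t j) ≤ 2 * δ) ∨
      ∃ j ≤ C, Γ.dist (p i) (u j) ≤ 2 * δ := by
  obtain ⟨r, r0, r1, hr, -⟩ := hc.exists_isGeodesicSegment (p 0) (t B)
  rcases hδ r (fun j => t (B - j)) p _ B L hr ht.reverse hp r0.symm (by simp [r1])
    (by simp [h1]) i hi with ⟨j, hj, hd⟩ | ⟨j, hj, hd⟩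
  · rcases hδ s u r A C _ hs hu hr (r0.trans h0.symm) h2.symm (r1.trans h3.symm) j hj with
      ⟨k, hk, hd'⟩ | ⟨k, hk, hd'⟩
    · have := hc.dist_triangle (u := p i) (v := r j) (w := s k)
      exact Or.inl ⟨k, hk, by omega⟩
    · have := hc.dist_triangle (u := p i) (v := r j) (w := u k)
      exact Or.inr (Or.inr ⟨k, hk, by omega⟩)
  · exact Or.inr (Or.inl ⟨B - j, by omega, by omega⟩)

/-- Geodesics of equal length whose endpoints are close are close to each other, and closer if one
stays away from the final endpoints. -/
theorem HasThinTriangles.dist_le_or_le (hδ : HasThinTriangles Γ δ) (hc : Γ.Connected)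
    {p q : ℕ → V} {M : ℕ} (hp : IsGeodesicSegment Γ p M) (hq : IsGeodesicSegment Γ q M) {i : ℕ}
    (hi : i ≤ M) :
    Γ.dist (p i) (q i) ≤ 3 * Γ.dist (p 0) (q 0) + 4 * δ ∨
      M ≤ i + Γ.dist (p M) (q M) + 2 * δ := by
  obtain ⟨s, s0, s1, hs, -⟩ := hc.exists_isGeodesicSegment (p 0) (q 0)
  obtain ⟨t, t0, t1, ht, -⟩ := hc.exists_isGeodesicSegment (p M) (q M)
  have pi := hp.dist_eq (Nat.zero_le i) hi
  have pM := hp.dist_eq hi le_rfl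
  have qi := hq.dist_eq (Nat.zero_le i) hi
  rcases hδ.quadrilateral hc hp hs ht hq s0 t0 s1.symm t1.symm hi with
    ⟨j, hj, hd⟩ | ⟨j, hj, hd⟩ | ⟨j, hj, hd⟩
  -- Near the initial side, `i ≤ d + 2δ` with `d = dist (p 0) (q 0)`, and the detour through `p 0`
  -- and `q 0` costs `2 * i + d`.
  · left
    have a := hs.dist_eq (Nat.zero_le j) hj
    rw [s0] at a
    have b := hc.dist_triangle (u := p 0) (v := s j) (w := p i)
    rw [SimpleGraph.dist_comm (u := s j)] at b
    have c := hc.dist_triangle (u := p i) (v := p 0) (w := q i)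
    have d := hc.dist_triangle (u := p 0) (v := q 0) (w := q i)
    rw [SimpleGraph.dist_comm (u := p i) (v := p 0)] at c
    omega
  · right
    have a := ht.dist_eq (Nat.zero_le j) hj
    rw [t0] at a
    have b := hc.dist_triangle (u := p i) (v := t j) (w := p M)
    rw [SimpleGraph.dist_comm (u := t j)] at b
    omega
  · left
    have a := hq.dist_eq (Nat.zero_le j) hj
    have b := hc.dist_triangle (u := p 0) (v := q 0) (w := q j)
    have c := hc.dist_triangle (u := p 0) (v := q j) (w := p i)
    have d := hc.dist_triangle (u := q 0) (v := p 0) (w := p i)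
    have e := hc.dist_triangle (u := q 0) (v := p i) (w := q j)
    have f := hc.dist_triangle (u := p i) (v := q j) (w := q i)
    rw [SimpleGraph.dist_comm (u := q j) (v := p i)] at c
    rw [SimpleGraph.dist_comm (u := q 0) (v := p 0)] at d
    rcases le_total i j with h | h
    · have g := hq.dist_eq h hj
      rw [SimpleGraph.dist_comm] at g
      omega
    · have g := hq.dist_eq h hi
      omega

/-- Triangles with one ideal vertex are thin: a side `η` from `τ 0` to `σ 0` is close to the union
of the asymptotic rays `τ` and `σ`. -/
theorem HasThinTriangles.ideal_triangle (hδ : HasThinTriangles Γ δ) (hc : Γ.Connected)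
    {η τ σ : ℕ → V} {L C : ℕ} (hη : IsGeodesicSegment Γ η L) (hτ : ∀ M, IsGeodesicSegment Γ τ M)
    (hσ : ∀ M, IsGeodesicSegment Γ σ M) (h0 : τ 0 = η 0) (h1 : σ 0 = η L)
    (hC : ∀ n, Γ.dist (τ n) (σ n) ≤ C) {m : ℕ} (hm : m ≤ L) :
    Γ.dist (η m) (τ m) ≤ 4 * δ ∨ ∃ k, Γ.dist (η m) (σ k) ≤ 2 * δ := by
  -- The side closing the quadrilateral at time `T` has length at most `C`; this `T` puts it out of
  -- reach of `η m`.
  set T := m + 2 * δ + C + 1 with hT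
  obtain ⟨s, s0, s1, hs, -⟩ := hc.exists_isGeodesicSegment (τ T) (σ T)
  have hm0 := hη.dist_eq (Nat.zero_le m) hm
  rw [← h0] at hm0
  rcases hδ.quadrilateral hc hη (hτ T) (hσ T) hs h0 h1 s0 s1 hm with
    ⟨j, hj, hd⟩ | ⟨j, hj, hd⟩ | ⟨j, hj, hd⟩
  · left
    have a := (hτ j).dist_eq (Nat.zero_le j) le_rfl
    have b := hc.dist_triangle (u := τ 0) (v := η m) (w := τ j)
    have c := hc.dist_triangle (u := τ 0) (v := τ j) (w := η m)
    have d := hc.dist_triangle (u := η m) (v := τ j) (w := τ m)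
    rw [SimpleGraph.dist_comm (u := τ j) (v := η m)] at c
    rcases le_total m j with h | h
    · have g := (hτ j).dist_eq h le_rfl
      rw [SimpleGraph.dist_comm] at g
      omega
    · have g := (hτ m).dist_eq h le_rfl
      omega
  · exact Or.inr ⟨j, hd⟩
  · exfalso
    have a := (hτ T).dist_eq (Nat.zero_le T) le_rfl
    have b := hs.dist_eq (Nat.zero_le j) hj
    rw [s0, SimpleGraph.dist_comm] at b
    have c := hc.dist_triangle (u := τ 0) (v := η m) (w := τ T)
    have d := hc.dist_triangle (u := η m) (v := s j) (w := τ T)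
    have e := hC T
    omega

end ThinPolygons

/-! ### Geodesic rays, compactness of the boundary, and the convergence action on it. -/

section GromovBoundary

variable {G : Type*} [Group G] {S : Set G}

theorem mulCayley_dist_mul_left (S : Set G) (g u v : G) :
    (SimpleGraph.mulCayley S).dist (g * u) (g * v) = (SimpleGraph.mulCayley S).dist u v :=
  congrArg ENat.toNat (mulCayley_edist_mul_left S g u v)

theorem IsGeodesicSegment.mul_left {p : ℕ → G} {M : ℕ}
    (hp : IsGeodesicSegment (SimpleGraph.mulCayley S) p M) (g : G) :
    IsGeodesicSegment (SimpleGraph.mulCayley S) (fun j => g * p j) M :=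
  fun i k hik => (mulCayley_dist_mul_left S g _ _).trans (hp i k hik)

theorem GeodesicRay.isGeodesicSegment (ρ : GeodesicRay S) (M : ℕ) :
    IsGeodesicSegment (SimpleGraph.mulCayley S) ρ.1 M :=
  fun i k _ => congrArg ENat.toNat (ρ.2 i k)

theorem GeodesicRay.dist_zero (ρ : GeodesicRay S) (n : ℕ) :
    (SimpleGraph.mulCayley S).dist (ρ.1 0) (ρ.1 n) = n :=
  (ρ.isGeodesicSegment n).dist_eq (Nat.zero_le n) le_rfl

theorem GeodesicRay.equiv_iff (hc : (SimpleGraph.mulCayley S).Connected) {ρ σ : GeodesicRay S} :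
    ρ ≈ σ ↔ ∃ C, ∀ n, (SimpleGraph.mulCayley S).dist (ρ.1 n) (σ.1 n) ≤ C :=
  exists_congr fun C => forall_congr' fun n => by
    rw [← (hc (ρ.1 n) (σ.1 n)).coe_dist_eq_edist, Nat.cast_le]

theorem GeodesicRay.exists_val_eq (hc : (SimpleGraph.mulCayley S).Connected) {f : ℕ → G}
    (hf : ∀ M, IsGeodesicSegment (SimpleGraph.mulCayley S) f M) : ∃ ρ : GeodesicRay S, ρ.1 = f :=
  ⟨⟨f, fun m k => by rw [← (hc (f m) (f (m + k))).coe_dist_eq_edist, hf (m + k) m k le_rfl]⟩, rfl⟩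

/-- The boundary point represented by a ray. -/
def GeodesicRay.toBoundary (ρ : GeodesicRay S) : GromovBoundary S :=
  Quotient.mk (asymptoticSetoid S) ρ

theorem GeodesicRay.toBoundary_eq_iff (hc : (SimpleGraph.mulCayley S).Connected)
    {ρ σ : GeodesicRay S} : ρ.toBoundary = σ.toBoundary ↔
      ∃ C, ∀ n, (SimpleGraph.mulCayley S).dist (ρ.1 n) (σ.1 n) ≤ C :=
  Quotient.eq.trans (GeodesicRay.equiv_iff hc)

theorem GeodesicRay.continuous_toBoundary :
    Continuous (GeodesicRay.toBoundary : GeodesicRay S → GromovBoundary S) :=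
  continuous_quotient_mk'

theorem GeodesicRay.tendsto_iff {ι : Type*} {l : Filter ι} {ρ : ι → GeodesicRay S}
    {σ : GeodesicRay S} : Tendsto ρ l (𝓝 σ) ↔ ∀ k, ∀ᶠ n in l, (ρ n).1 k = σ.1 k := by
  let _ : TopologicalSpace G := ⊥
  have : DiscreteTopology G := ⟨rfl⟩
  have h : IsInducing (fun ρ : GeodesicRay S => ρ.1) := ⟨rfl⟩
  rw [h.tendsto_nhds_iff, tendsto_pi_nhds]
  simp only [nhds_discrete, tendsto_pure, Function.comp_apply]

instance (S : Set G) : FirstCountableTopology (GeodesicRay S) := by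
  let _ : TopologicalSpace G := ⊥
  have : DiscreteTopology G := ⟨rfl⟩
  have h : IsInducing (fun ρ : GeodesicRay S => ρ.1) := ⟨rfl⟩
  exact h.firstCountableTopology

theorem finite_setOf_mulCayley_dist_le (hS : S.Finite)
    (hc : (SimpleGraph.mulCayley S).Connected) (u : G) (k : ℕ) :
    {v | (SimpleGraph.mulCayley S).dist u v ≤ k}.Finite := by
  induction k with
  | zero =>
    refine (finite_singleton u).subset fun v hv => ?_
    exact (hc.dist_eq_zero_iff.1 (Nat.le_zero.1 hv)).symm
  | succ k ih =>
    refine (ih.union ((ih.mul hS).union (ih.mul hS.inv))).subset fun v hv => ?_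
    obtain ⟨p, h0, h1, hp, -⟩ := hc.exists_isGeodesicSegment u v
    rcases Nat.eq_zero_or_pos ((SimpleGraph.mulCayley S).dist u v) with h | h
    · exact Or.inl (show _ ≤ k by omega)
    · set d := (SimpleGraph.mulCayley S).dist u v with hd
      have hw := hp.dist_eq (Nat.zero_le (d - 1)) (Nat.sub_le _ _)
      have ha := hp.dist_eq (i := d - 1) (Nat.sub_le _ _) le_rfl
      rw [h0] at hw
      rw [h1, show d - (d - 1) = 1 by omega, SimpleGraph.dist_eq_one_iff_adj,
        SimpleGraph.mulCayley_adj] at ha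
      replace hv : d ≤ k + 1 := hv
      have hm : p (d - 1) ∈ {v | (SimpleGraph.mulCayley S).dist u v ≤ k} := show _ ≤ k by omega
      rcases ha.2 with hs | hs
      · exact Or.inr (Or.inl ⟨_, hm, _, hs, by simp⟩)
      · exact Or.inr (Or.inr ⟨_, hm, _, Set.inv_mem_inv.2 hs, by simp⟩)

namespace IsHyperbolicGeneratingSet

variable (hS : IsHyperbolicGeneratingSet S)
include hS

theorem connected : (SimpleGraph.mulCayley S).Connected := hS.hyperbolic.1

theorem exists_subseq_tendsto {f : ℕ → ℕ → G}
    (hf : ∀ n k, (SimpleGraph.mulCayley S).dist 1 (f n k) ≤ k) :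
    ∃ (F : ℕ → G) (φ : ℕ → ℕ), StrictMono φ ∧ ∀ k, ∀ᶠ n in atTop, f (φ n) k = F k := by
  let _ : TopologicalSpace G := ⊥
  have : DiscreteTopology G := ⟨rfl⟩
  have hK : IsCompact (Set.pi univ fun k => {v | (SimpleGraph.mulCayley S).dist 1 v ≤ k}) :=
    isCompact_univ_pi fun k => (finite_setOf_mulCayley_dist_le hS.finite hS.connected 1 k).isCompact
  obtain ⟨F, -, φ, hφ, h⟩ := hK.tendsto_subseq (x := f) fun n k _ => hf n k
  refine ⟨F, φ, hφ, fun k => ?_⟩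
  have := tendsto_pi_nhds.1 h k
  rwa [nhds_discrete, tendsto_pure] at this

/-- Arzelà–Ascoli: balls are finite, so pointwise limits stabilize on initial segments. `hg` allows
finite geodesics, provided their lengths tend to infinity. -/
theorem exists_subseq_tendsto_ray {f : ℕ → ℕ → G}
    (hf : ∀ n k, (SimpleGraph.mulCayley S).dist 1 (f n k) ≤ k) (hf0 : ∀ n, f n 0 = 1)
    (hg : ∀ M, ∀ᶠ n in atTop, IsGeodesicSegment (SimpleGraph.mulCayley S) (f n) M) :
    ∃ (ρ : GeodesicRay S) (φ : ℕ → ℕ), ρ.1 0 = 1 ∧ StrictMono φ ∧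
      ∀ k, ∀ᶠ n in atTop, f (φ n) k = ρ.1 k := by
  obtain ⟨F, φ, hφ, h⟩ := hS.exists_subseq_tendsto hf
  obtain ⟨ρ, rfl⟩ := GeodesicRay.exists_val_eq (f := F) hS.connected (by
    intro M i k hik
    obtain ⟨n, h1, h2, h3⟩ := ((h i).and ((h (i + k)).and
      (hφ.tendsto_atTop.eventually (hg M)))).exists
    rw [← h1, ← h2]
    exact h3 i k hik)
  refine ⟨ρ, φ, ?_, hφ, h⟩
  obtain ⟨n, hn⟩ := (h 0).exists
  rw [← hn, hf0]

/-- A sequence of rays from `1` has a convergent subsequence. -/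
theorem exists_subseq_rays {σ : ℕ → GeodesicRay S} (h : ∀ n, (σ n).1 0 = 1) :
    ∃ (ρ : GeodesicRay S) (φ : ℕ → ℕ), ρ.1 0 = 1 ∧ StrictMono φ ∧
      ∀ k, ∀ᶠ n in atTop, (σ (φ n)).1 k = ρ.1 k :=
  hS.exists_subseq_tendsto_ray (fun n k => by rw [← h n, GeodesicRay.dist_zero]) h
    fun M => Eventually.of_forall fun n => (σ n).isGeodesicSegment M

/-- The bound depends only on the initial points, so being asymptotic survives pointwise limits of
rays. It follows by comparing the rays up to a time `M` too late for the far ends to matter. -/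
theorem dist_le_of_toBoundary_eq {δ : ℕ} (hδ : HasThinTriangles (SimpleGraph.mulCayley S) δ)
    {ρ σ : GeodesicRay S} (h : ρ.toBoundary = σ.toBoundary) (n : ℕ) :
    (SimpleGraph.mulCayley S).dist (ρ.1 n) (σ.1 n) ≤
      3 * (SimpleGraph.mulCayley S).dist (ρ.1 0) (σ.1 0) + 4 * δ := by
  obtain ⟨C, hC⟩ := (GeodesicRay.toBoundary_eq_iff hS.connected).1 h
  set M := n + C + 2 * δ + 1 with hM
  have := hC M
  rcases hδ.dist_le_or_le hS.connected (ρ.isGeodesicSegment M) (σ.isGeodesicSegment M)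
    (i := n) (by omega) with h | h <;> omega

/-- Every boundary point is represented by a ray from `1`. -/
theorem exists_ray (x : GromovBoundary S) : ∃ ρ : GeodesicRay S, ρ.1 0 = 1 ∧ ρ.toBoundary = x := by
  obtain ⟨δ, hδ⟩ := hS.hyperbolic.exists_hasThinTriangles
  have hc := hS.connected
  induction x using Quotient.inductionOn with | h ρ => ?_
  choose s s0 s1 hs hb using fun n => hc.exists_isGeodesicSegment 1 (ρ.1 n)
  set D := (SimpleGraph.mulCayley S).dist 1 (ρ.1 0) with hD
  have hl : ∀ n, n - D ≤ (SimpleGraph.mulCayley S).dist 1 (ρ.1 n) ∧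
      (SimpleGraph.mulCayley S).dist 1 (ρ.1 n) ≤ n + D := by
    intro n
    have a := ρ.dist_zero n
    have b := hc.dist_triangle (u := ρ.1 0) (v := 1) (w := ρ.1 n)
    have c := hc.dist_triangle (u := 1) (v := ρ.1 0) (w := ρ.1 n)
    rw [SimpleGraph.dist_comm (u := ρ.1 0) (v := 1)] at b
    omega
  obtain ⟨σ, φ, hσ, hφ, h⟩ := hS.exists_subseq_tendsto_ray hb s0 fun M =>
    (eventually_ge_atTop (M + D)).mono fun n hn => (hs n).mono (by have := (hl n).1; omega)
  refine ⟨σ, hσ, (GeodesicRay.toBoundary_eq_iff hc).2 ⟨3 * D + 4 * δ, fun k => ?_⟩⟩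
  obtain ⟨n, h1, h2⟩ := ((h k).and
    (hφ.tendsto_atTop.eventually_ge_atTop (k + D + 3 * D + 2 * δ + 1))).exists
  rw [← h1]
  generalize φ n = n at h2
  obtain ⟨l1, l2⟩ := hl n
  -- Cutting both geodesics at `n - D` makes their lengths equal. The cut removes at most `2 * D`
  -- from `s n` and at most `D` from `ρ`, which met at `ρ.1 n`.
  have e : (SimpleGraph.mulCayley S).dist (s n (n - D)) (ρ.1 (n - D)) ≤ 3 * D := by
    have a := (hs n).dist_eq l1 le_rfl
    have b := (ρ.isGeodesicSegment n).dist_eq (Nat.sub_le n D) le_rfl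
    have c := hc.dist_triangle (u := s n (n - D)) (v := ρ.1 n) (w := ρ.1 (n - D))
    rw [s1 n] at a
    rw [SimpleGraph.dist_comm] at b
    omega
  rcases hδ.dist_le_or_le hc ((hs n).mono l1) (ρ.isGeodesicSegment (n - D)) (i := k) (by omega)
    with h | h
  · rwa [s0] at h
  · omega

/-- The rays from `1` form a closed subset of a product of finite balls, and they represent every
boundary point. -/
theorem compactSpace : CompactSpace (GromovBoundary S) := by
  let _ : TopologicalSpace G := ⊥
  have : DiscreteTopology G := ⟨rfl⟩
  have hind : IsInducing (fun ρ : GeodesicRay S => ρ.1) := ⟨rfl⟩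
  have hK : IsCompact {ρ : GeodesicRay S | ρ.1 0 = 1} := by
    rw [hind.isCompact_iff]
    refine (isCompact_univ_pi fun k => (finite_setOf_mulCayley_dist_le hS.finite hS.connected
      1 k).isCompact).of_isClosed_subset ?_ (s := Set.pi univ fun k =>
        {v | (SimpleGraph.mulCayley S).dist 1 v ≤ k}) ?_
    · have : (fun ρ : GeodesicRay S => ρ.1) '' {ρ : GeodesicRay S | ρ.1 0 = 1} =
          {f | f 0 = 1} ∩ ⋂ i, ⋂ k,
            {f : ℕ → G | (SimpleGraph.mulCayley S).dist (f i) (f (i + k)) = k} := by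
        ext f
        simp only [mem_image, mem_inter_iff, mem_iInter, mem_ofPred_eq]
        constructor
        · rintro ⟨ρ, h, rfl⟩
          exact ⟨h, fun i k => ρ.isGeodesicSegment (i + k) i k le_rfl⟩
        · rintro ⟨h0, h⟩
          obtain ⟨ρ, rfl⟩ := GeodesicRay.exists_val_eq hS.connected fun M i k _ => h i k
          exact ⟨ρ, h0, rfl⟩
      rw [this]
      refine (isClosed_eq (continuous_apply 0) continuous_const).inter
        (isClosed_iInter fun i => isClosed_iInter fun k => ?_)
      have hcont : Continuous fun f : ℕ → G => (f i, f (i + k)) :=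
        (continuous_apply i).prodMk (continuous_apply (i + k))
      exact (isClosed_discrete
        {q : G × G | (SimpleGraph.mulCayley S).dist q.1 q.2 = k}).preimage hcont
    · rintro _ ⟨ρ, h, rfl⟩ k -
      exact (h ▸ ρ.dist_zero k).le
  refine ⟨?_⟩
  convert hK.image GeodesicRay.continuous_toBoundary
  refine (eq_univ_of_forall fun x => ?_).symm
  obtain ⟨ρ, h, rfl⟩ := hS.exists_ray x
  exact ⟨ρ, h, rfl⟩

end IsHyperbolicGeneratingSet

/-- The points represented by rays from `1` which are `C`-close to `α` up to time `N`. -/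
def boundaryShadow (α : GeodesicRay S) (C N : ℕ) : Set (GromovBoundary S) :=
  {x | ∃ σ : GeodesicRay S, σ.1 0 = 1 ∧ σ.toBoundary = x ∧
    ∀ n ≤ N, (SimpleGraph.mulCayley S).dist (σ.1 n) (α.1 n) ≤ C}

theorem boundaryShadow_antitone (α : GeodesicRay S) (C : ℕ) : Antitone (boundaryShadow α C) :=
  fun _ _ h _ ⟨σ, h0, h1, h2⟩ => ⟨σ, h0, h1, fun n hn => h2 n (hn.trans h)⟩

namespace IsHyperbolicGeneratingSet

variable (hS : IsHyperbolicGeneratingSet S)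
include hS

theorem isClosed_boundaryShadow (α : GeodesicRay S) (C N : ℕ) :
    IsClosed (boundaryShadow α C N) := by
  obtain ⟨δ, hδ⟩ := hS.hyperbolic.exists_hasThinTriangles
  have hq : IsQuotientMap (GeodesicRay.toBoundary : GeodesicRay S → GromovBoundary S) :=
    isQuotientMap_quotient_mk'
  rw [← hq.isClosed_preimage, ← isSeqClosed_iff_isClosed]
  intro ρ ρ' hρ hlim
  rw [GeodesicRay.tendsto_iff] at hlim
  choose σ h0 h1 h2 using hρ
  obtain ⟨σ', φ, h0', hφ, h⟩ := hS.exists_subseq_rays h0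
  refine ⟨σ', h0', ?_, fun n hn => ?_⟩
  · refine (GeodesicRay.toBoundary_eq_iff hS.connected).2
      ⟨3 * (SimpleGraph.mulCayley S).dist (σ'.1 0) (ρ'.1 0) + 4 * δ, fun n => ?_⟩
    obtain ⟨k, a, b, c, d⟩ := ((h n).and ((h 0).and ((hφ.tendsto_atTop.eventually (hlim n)).and
      (hφ.tendsto_atTop.eventually (hlim 0))))).exists
    rw [← a, ← b, ← c, ← d]
    exact hS.dist_le_of_toBoundary_eq hδ (h1 (φ k)) n
  · obtain ⟨k, a⟩ := (h n).exists
    rw [← a]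
    exact h2 _ n hn

/-- The shadows are closed and decreasing, and any point in all of them is represented by a ray
asymptotic to `α`; compactness of `K` then gives a single `N`. -/
theorem exists_disjoint_boundaryShadow (α : GeodesicRay S) (C : ℕ)
    {K : Set (GromovBoundary S)} (hK : IsCompact K) (hα : α.toBoundary ∉ K) :
    ∃ N, Disjoint K (boundaryShadow α C N) := by
  obtain ⟨δ, hδ⟩ := hS.hyperbolic.exists_hasThinTriangles
  have hc := hS.connected
  obtain ⟨N, hN⟩ := hK.elim_directed_family_closed (boundaryShadow α C)
    (hS.isClosed_boundaryShadow α C) (by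
      rw [eq_empty_iff_forall_notMem]
      rintro x ⟨hxK, hx⟩
      rw [mem_iInter] at hx
      obtain ⟨ρ, h0, rfl⟩ := hS.exists_ray x
      refine hα (Eq.subst (motive := (· ∈ K)) (Eq.symm ?_) hxK)
      refine (GeodesicRay.toBoundary_eq_iff hc).2 ⟨C + 4 * δ, fun n => ?_⟩
      obtain ⟨σ, h0', h1, h2⟩ := hx n
      have a := hS.dist_le_of_toBoundary_eq hδ h1 n
      rw [h0, h0', SimpleGraph.dist_self] at a
      have b := h2 n le_rfl
      have c := hc.dist_triangle (u := α.1 n) (v := σ.1 n) (w := ρ.1 n)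
      rw [SimpleGraph.dist_comm (u := α.1 n) (v := σ.1 n)] at c
      omega) (boundaryShadow_antitone α C).directed_ge
  exact ⟨N, disjoint_iff_inter_eq_empty.2 hN⟩

/-- A word-hyperbolic group acts on its boundary as a convergence group. -/
theorem isConvergenceAction : IsConvergenceAction G (GromovBoundary S) := by
  obtain ⟨δ, hδ⟩ := hS.hyperbolic.exists_hasThinTriangles
  have hc := hS.connected
  intro g hg
  choose γ γ0 γ1 hγ hb using fun n => hc.exists_isGeodesicSegment 1 (g n)⁻¹
  set L : ℕ → ℕ := fun n => (SimpleGraph.mulCayley S).dist 1 (g n)⁻¹ with hL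
  have hLg : ∀ M, ∀ᶠ n in atTop, M ≤ L n := by
    intro M
    have hinj : Function.Injective fun n => (g n)⁻¹ := inv_injective.comp hg
    have hfin := (finite_setOf_mulCayley_dist_le hS.finite hc 1 M).preimage
      (f := fun n => (g n)⁻¹) hinj.injOn
    rw [← Nat.cofinite_eq_atTop]
    filter_upwards [hfin.compl_mem_cofinite] with n hn
    exact (not_le.1 (show ¬L n ≤ M from hn)).le
  -- `η n` runs from `1` to `g n` and, by truncated subtraction, stays there. Limits of `γ` give the
  -- repelling point `α`, limits of `η` the attracting point `β`.
  let η : ℕ → ℕ → G := fun n j => g n * γ n (L n - j)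
  have η0 : ∀ n, η n 0 = 1 := fun n => by simp [η, L, γ1]
  have hη : ∀ n, IsGeodesicSegment (SimpleGraph.mulCayley S) (η n) (L n) := fun n =>
    (hγ n).reverse.mul_left (g n)
  have hηb : ∀ n k, (SimpleGraph.mulCayley S).dist 1 (η n k) ≤ k := by
    intro n k
    have h : η n k = η n (min k (L n)) := by
      simp only [η]
      congr 2
      omega
    have := (hη n).dist_eq (Nat.zero_le (min k (L n))) (min_le_right _ _)
    rw [η0, ← h] at this
    omega
  obtain ⟨α, φ, α0, hφ, hα⟩ := hS.exists_subseq_tendsto_ray hb γ0 fun M =>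
    (hLg M).mono fun n hn => (hγ n).mono hn
  obtain ⟨β, ψ, β0, hψ, hβ⟩ := hS.exists_subseq_tendsto_ray (f := fun n => η (φ n))
    (fun n => hηb (φ n)) (fun n => η0 (φ n)) fun M =>
      (hφ.tendsto_atTop.eventually (hLg M)).mono fun n hn => (hη (φ n)).mono hn
  refine ⟨α.toBoundary, β.toBoundary, φ ∘ ψ, hφ.comp hψ, fun K hK hKα U hU => ?_⟩
  by_contra hcon
  rw [not_eventually] at hcon
  obtain ⟨χ, hχ, hbad⟩ := extraction_of_frequently_atTop hcon
  push Not at hbad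
  choose x hxK hxU using hbad
  choose ρ ρ0 hρ using fun n => hS.exists_ray (x n)
  choose τ τ0 hτ using fun n => hS.exists_ray (g ((φ ∘ ψ) (χ n)) • x n)
  obtain ⟨N, hN⟩ := hS.exists_disjoint_boundaryShadow α (4 * δ) hK fun h => hKα h rfl
  obtain ⟨τ', ω, τ0', hω, hτ'⟩ := hS.exists_subseq_rays τ0
  have hκ : Tendsto (fun n => ψ (χ (ω n))) atTop atTop :=
    ((hψ.comp hχ).comp hω).tendsto_atTop
  -- In the ideal triangle with vertices `1`, `g`, `g • x`, the point `η m` is close to `τ` or to `g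
  -- • ρ`. In the second case, translating by `g⁻¹` makes `ρ` follow `γ`, hence `α` up to time `N`,
  -- so `x` lies in the shadow that `K` avoids.
  have close : ∀ m, ∀ᶠ n in atTop, (SimpleGraph.mulCayley S).dist
      (η (φ (ψ (χ n))) m) ((τ n).1 m) ≤ 4 * δ := by
    intro m
    have hκ' : Tendsto (fun n => ψ (χ n)) atTop atTop := (hψ.comp hχ).tendsto_atTop
    have hαN : ∀ᶠ n in atTop, ∀ j ≤ N, γ (φ (ψ (χ n))) j = α.1 j := by
      have := (Finset.range (N + 1)).eventually_all.2 fun j _ => hκ'.eventually (hα j)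
      filter_upwards [this] with n hn j hj
      exact hn j (Finset.mem_range.2 (Nat.lt_succ_of_le hj))
    -- The end distance at time `L k - m` is at most `4 * δ`; `dist_le_or_le` adds `2 * δ`, hence
    -- the `6 * δ`.
    filter_upwards [hαN, hκ'.eventually (hφ.tendsto_atTop.eventually
      (hLg (N + m + 6 * δ + 1)))] with n h1 h2
    have hτn := hτ n
    have hηn := hη (φ (ψ (χ n)))
    have hη0 := η0 (φ (ψ (χ n)))
    have hγn := hγ (φ (ψ (χ n)))
    have hγ0 := γ0 (φ (ψ (χ n)))
    simp only [Function.comp_apply] at hτn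
    simp only [η] at hηn hη0 ⊢
    change IsGeodesicSegment _ _ (L (φ (ψ (χ n)))) at hγn
    generalize φ (ψ (χ n)) = k at *
    obtain ⟨C, hC⟩ := (GeodesicRay.toBoundary_eq_iff (σ := g k • ρ n) hc).1
      (hτn.trans (by rw [← hρ n]; rfl))
    refine (hδ.ideal_triangle hc hηn (τ n).isGeodesicSegment (g k • ρ n).isGeodesicSegment
      ((τ0 n).trans hη0.symm) ?_ hC (m := m) (by omega)).resolve_right ?_
    · change g k * (ρ n).1 0 = _
      simp [ρ0, hγ0]
    · rintro ⟨j, hj⟩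
      change (SimpleGraph.mulCayley S).dist (g k * γ k (L k - m)) (g k * (ρ n).1 j) ≤ 2 * δ at hj
      rw [mulCayley_dist_mul_left] at hj
      have hd : (SimpleGraph.mulCayley S).dist (γ k (L k - m)) ((ρ n).1 (L k - m)) ≤ 4 * δ := by
        have a := hγn.dist_eq (Nat.zero_le (L k - m)) (by omega)
        have b := (ρ n).dist_zero j
        rw [hγ0] at a
        rw [ρ0] at b
        have c := hc.dist_triangle (u := 1) (v := γ k (L k - m)) (w := (ρ n).1 j)
        have d := hc.dist_triangle (u := 1) (v := (ρ n).1 j) (w := γ k (L k - m))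
        rw [SimpleGraph.dist_comm (u := (ρ n).1 j)] at d
        have e := hc.dist_triangle (u := γ k (L k - m)) (v := (ρ n).1 j) (w := (ρ n).1 (L k - m))
        rcases le_total j (L k - m) with h | h
        · have := ((ρ n).isGeodesicSegment (L k - m)).dist_eq h le_rfl
          omega
        · have := ((ρ n).isGeodesicSegment j).dist_eq h le_rfl
          rw [SimpleGraph.dist_comm] at this
          omega
      refine disjoint_left.1 hN (hxK n) ⟨ρ n, ρ0 n, hρ n, fun i hi => ?_⟩
      rw [← h1 i hi, SimpleGraph.dist_comm]
      rcases hδ.dist_le_or_le hc (hγn.mono (Nat.sub_le _ m)) ((ρ n).isGeodesicSegment (L k - m))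
        (i := i) (by omega) with h | h
      · rwa [hγ0, ρ0, SimpleGraph.dist_self, mul_zero, zero_add] at h
      · omega
  have hb' : τ'.toBoundary = β.toBoundary := by
    refine (GeodesicRay.toBoundary_eq_iff hc).2 ⟨4 * δ, fun m => ?_⟩
    obtain ⟨n, a, b, c⟩ := ((hω.tendsto_atTop.eventually (close m)).and ((hτ' m).and
      (((hχ.comp hω).tendsto_atTop).eventually (hβ m)))).exists
    simp only [Function.comp_apply] at c
    rw [b, c, SimpleGraph.dist_comm] at a
    exact a
  have hlim : Tendsto (fun n => (τ (ω n)).toBoundary) atTop (𝓝 β.toBoundary) :=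
    hb' ▸ (GeodesicRay.continuous_toBoundary.tendsto τ').comp (GeodesicRay.tendsto_iff.2 hτ')
  obtain ⟨n, hn⟩ := (hlim.eventually hU).exists
  rw [hτ] at hn
  exact hxU _ hn

theorem exists_subseq_tendsto_boundary (x : ℕ → GromovBoundary S) :
    ∃ (y : GromovBoundary S) (φ : ℕ → ℕ), StrictMono φ ∧ Tendsto (x ∘ φ) atTop (𝓝 y) := by
  choose ρ ρ0 hρ using fun n => hS.exists_ray (x n)
  obtain ⟨σ, φ, -, hφ, h⟩ := hS.exists_subseq_rays ρ0
  refine ⟨σ.toBoundary, φ, hφ, ?_⟩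
  rw [show x = fun n => (ρ n).toBoundary from funext fun n => (hρ n).symm]
  exact (GeodesicRay.continuous_toBoundary.tendsto σ).comp (GeodesicRay.tendsto_iff.2 h)

end IsHyperbolicGeneratingSet

end GromovBoundary

/-! ### Convergence sequences and non-elementary actions. -/

section ConvergenceSequences

variable {G : Type*} [Group G] {X : Type*} [TopologicalSpace X] [MulAction G X]

theorem ConvergesToConstOff.tendsto {g : ℕ → G} {a b y : X} (h : ConvergesToConstOff g a b)
    (hy : y ≠ a) : Tendsto (fun n => g n • y) atTop (𝓝 b) := fun U hU =>
  (h {y} isCompact_singleton (singleton_subset_iff.2 hy) U hU).mono fun _ hn => hn y rfl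

theorem ConvergesToConstOff.comp {g : ℕ → G} {a b : X} (h : ConvergesToConstOff g a b)
    {φ : ℕ → ℕ} (hφ : StrictMono φ) : ConvergesToConstOff (fun n => g (φ n)) a b :=
  fun K hK ha U hU => hφ.tendsto_atTop.eventually (h K hK ha U hU)

-- Applied to the range of `i`, this provides points whose images avoid two prescribed points of
-- `Z`.
omit [TopologicalSpace X] in
theorem exists_ne_of_not_isElementaryAction (hne : ¬IsElementaryAction G X) {A : Set X}
    (hA : A.Nonempty) (hinv : ∀ g : G, ∀ y ∈ A, g • y ∈ A) (u v : X) : ∃ y ∈ A, y ≠ u ∧ y ≠ v := by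
  by_contra! h
  refine hne (Or.inr ⟨A, hA, (encard_le_encard (t := {u, v}) fun y hy => ?_).trans
    ((encard_insert_le _ _).trans_eq (by rw [encard_singleton, one_add_one_eq_two])), fun g => ?_⟩)
  · by_cases hu : y = u
    · exact Or.inl hu
    · exact Or.inr (h y hy hu)
  · refine Subset.antisymm (image_subset_iff.2 fun y hy => hinv g y hy) fun y hy => ?_
    exact ⟨g⁻¹ • y, hinv _ y hy, smul_inv_smul g y⟩

end ConvergenceSequences

/-! ### Transfer of convergence and conical sequences along an equivariant map. -/

section EquivariantMaps

variable {G : Type*} [Group G] {X Z : Type*} [TopologicalSpace X] [MulAction G X] [CompactSpace X]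
  [TopologicalSpace Z] [MulAction G Z] [CompactSpace Z] [T2Space Z] {i : X → Z}

/-- Under a continuous equivariant map, the attracting and repelling points of a convergence
sequence correspond. -/
theorem ConvergesToConstOff.eq_map (hi : Continuous i) (heq : ∀ (g : G) x, i (g • x) = g • i x)
    (hr : ∀ u v, ∃ x, i x ≠ u ∧ i x ≠ v) {g : ℕ → G} {a b : X} {c d : Z}
    (hX : ConvergesToConstOff g a b) (hZ : ConvergesToConstOff g c d) : c = i a ∧ d = i b := by
  have hd : d = i b := by
    obtain ⟨x, hxa, hxc⟩ := hr (i a) c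
    have h1 := (hi.tendsto b).comp (hX.tendsto fun h => hxa (congrArg i h))
    refine tendsto_nhds_unique (hZ.tendsto hxc) (h1.congr fun n => heq _ _)
  refine ⟨?_, hd⟩
  -- With `V` a closed neighbourhood of `c` missing `i a`, both `i ⁻¹' V` and the complement of
  -- `interior V` are eventually moved off the fibre of `x` and the point `i x`. Then `i ((g n)⁻¹ •
  -- x)` can lie neither in `V` nor outside it.
  by_contra hc
  obtain ⟨V, hV, hVc, hVa⟩ : ∃ V ∈ 𝓝 c, IsClosed V ∧ i a ∉ V := by
    obtain ⟨V, hV, hVc, hVs⟩ := exists_mem_nhds_isClosed_subset (isOpen_ne.mem_nhds hc)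
    exact ⟨V, hV, hVc, fun h => hVs h rfl⟩
  obtain ⟨x, hxd, -⟩ := hr d d
  have hU : {i x}ᶜ ∈ 𝓝 d := isOpen_compl_singleton.mem_nhds (Ne.symm hxd)
  have e1 := hX (i ⁻¹' V) (hVc.preimage hi).isCompact (fun y hy h => hVa (h ▸ hy))
    (i ⁻¹' {i x}ᶜ) (hi.continuousAt (hd ▸ hU))
  have e2 := hZ (interior V)ᶜ isOpen_interior.isClosed_compl.isCompact
    (fun y hy h => hy (mem_interior_iff_mem_nhds.2 (h ▸ hV))) _ hU
  obtain ⟨n, h1, h2⟩ := (e1.and e2).exists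
  have hx : i x = g n • i ((g n)⁻¹ • x) := by rw [← heq, smul_inv_smul]
  by_cases hm : i ((g n)⁻¹ • x) ∈ V
  · refine h1 _ hm ?_
    rw [smul_inv_smul]
    rfl
  · exact h2 _ (fun h => hm (interior_subset h)) hx.symm

/-- A convergence sequence of the source is one of the target. -/
theorem ConvergesToConstOff.map (hconv : IsConvergenceAction G Z) (hi : Continuous i)
    (heq : ∀ (g : G) x, i (g • x) = g • i x) (hr : ∀ u v, ∃ x, i x ≠ u ∧ i x ≠ v) {g : ℕ → G}
    (hg : Function.Injective g) {a b : X} (hX : ConvergesToConstOff g a b) :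
    ConvergesToConstOff g (i a) (i b) := by
  intro K hK hKa U hU
  by_contra hcon
  rw [not_eventually] at hcon
  obtain ⟨φ, hφ, hbad⟩ := extraction_of_frequently_atTop hcon
  obtain ⟨c, d, ψ, hψ, hZ⟩ := hconv (fun n => g (φ n)) (hg.comp hφ.injective)
  -- Every subsequence violating convergence contains a convergence subsequence with these same
  -- forced poles.
  obtain ⟨rfl, rfl⟩ := ((hX.comp hφ).comp hψ).eq_map hi heq hr hZ
  obtain ⟨n, hn⟩ := (hZ K hK hKa U hU).exists
  exact hbad _ hn

/-- A conical sequence for `x` is one for `i x`, unless `i` identifies its poles. -/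
theorem IsConicalSequence.map (hconv : IsConvergenceAction G Z) (hi : Continuous i)
    (heq : ∀ (g : G) x, i (g • x) = g • i x) (hr : ∀ u v, ∃ x, i x ≠ u ∧ i x ≠ v) {g : ℕ → G}
    {x xm xp : X} (hx : IsConicalSequence g x xm xp) (hne : i xm ≠ i xp) :
    IsConicalSequence g (i x) (i xm) (i xp) where
  injective := hx.injective
  ne := hne
  tendsto := ((hi.tendsto xp).comp hx.tendsto).congr fun _ => heq _ _
  converges := hx.converges.map hconv hi heq hr hx.injective

omit [CompactSpace X] [CompactSpace Z] in
/-- The poles of a conical sequence for a point of a nontrivial fibre are identified. -/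
theorem IsConicalSequence.map_eq_of_ne (hi : Continuous i)
    (heq : ∀ (g : G) x, i (g • x) = g • i x) {g : ℕ → G} {x y xm xp : X}
    (hx : IsConicalSequence g x xm xp) (hyx : y ≠ x) (hxy : i y = i x) : i xm = i xp := by
  have h1 := (hi.tendsto xm).comp (hx.converges.tendsto hyx)
  have h2 := (hi.tendsto xp).comp hx.tendsto
  refine tendsto_nhds_unique h1 (h2.congr fun n => ?_)
  simp only [Function.comp_apply, heq, hxy]

/-- A conical limit point lifts: any `x` over it has a conical sequence whose poles are not
identified. -/
theorem IsConicalLimitPoint.exists_lift (hX : IsConvergenceAction G X)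
    (hseq : ∀ x : ℕ → X, ∃ (y : X) (φ : ℕ → ℕ), StrictMono φ ∧ Tendsto (x ∘ φ) atTop (𝓝 y))
    (hi : Continuous i) (heq : ∀ (g : G) x, i (g • x) = g • i x)
    (hr : ∀ u v, ∃ x, i x ≠ u ∧ i x ≠ v) {x : X} (hx : IsConicalLimitPoint G (i x)) :
    ∃ (g : ℕ → G) (xm xp : X), IsConicalSequence g x xm xp ∧ i xm ≠ i xp := by
  obtain ⟨g, zm, zp, hg, hne, ht, hz⟩ := hx
  obtain ⟨a, b, φ, hφ, hab⟩ := hX g hg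
  obtain ⟨hxa, rfl⟩ := hab.eq_map hi heq hr (hz.comp hφ)
  have ht' := ht.comp hφ.tendsto_atTop
  -- Otherwise `g (φ n) • x → b`, so `g (φ n) • i x` would tend to `i b`, the pole `zm`, as well as
  -- to `zp`.
  obtain rfl : x = a := by
    by_contra hne'
    refine hne (tendsto_nhds_unique ?_ ht')
    exact ((hi.tendsto b).comp (hab.tendsto hne')).congr fun n => heq _ _
  obtain ⟨xp, ψ, hψ, hxp⟩ := hseq fun n => g (φ n) • x
  have hp : i xp = zp := by
    refine tendsto_nhds_unique ((hi.tendsto xp).comp hxp) ?_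
    exact (ht'.comp hψ.tendsto_atTop).congr fun n => (heq _ _).symm
  exact ⟨fun n => g (φ (ψ n)), b, xp, ⟨hg.comp (hφ.comp hψ).injective,
    fun h => hne (by rw [h, hp]), hxp, hab.comp hψ⟩, by rwa [hp]⟩

end EquivariantMaps

theorem theoremA {G : Type*} [Group G] (S : Set G) (hS : IsHyperbolicGeneratingSet S)
    {Z : Type*} [TopologicalSpace Z] [CompactSpace Z] [TopologicalSpace.MetrizableSpace Z]
    [MulAction G Z] [ContinuousConstSMul G Z]
    (hconv : IsConvergenceAction G Z) (hne : ¬ IsElementaryAction G Z)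
    (i : GromovBoundary S → Z) (hi : IsCannonThurstonMap i) (z : Z) (hz : z ∈ Set.range i) :
    (¬ IsConicalLimitPoint G z ↔ ∃ x ∈ i ⁻¹' {z}, IsAsymptoticTo x (laminationOf i)) ∧
    (1 < (i ⁻¹' {z}).encard →
      (∀ x ∈ i ⁻¹' {z}, IsAsymptoticTo x (laminationOf i)) ∧ ¬ IsConicalLimitPoint G z) := by
  have := hS.compactSpace
  have hr : ∀ u v, ∃ x, i x ≠ u ∧ i x ≠ v := by
    intro u v
    obtain ⟨_, ⟨x, rfl⟩, h⟩ := exists_ne_of_not_isElementaryAction hne ⟨z, hz⟩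
      (by rintro g _ ⟨x, rfl⟩; exact ⟨g • x, hi.equivariant g x⟩) u v
    exact ⟨x, h⟩
  have hlift : ∀ x ∈ i ⁻¹' {z}, IsAsymptoticTo x (laminationOf i) → ¬IsConicalLimitPoint G z := by
    rintro x rfl hx hcon
    obtain ⟨g, xm, xp, h, hneq⟩ := hcon.exists_lift hS.isConvergenceAction
      hS.exists_subseq_tendsto_boundary hi.continuous hi.equivariant hr
    exact hneq (hx g xm xp h).1
  refine ⟨⟨fun h => ?_, fun ⟨x, hx, h⟩ => hlift x hx h⟩, fun h => ?_⟩
  · obtain ⟨x, rfl⟩ := hz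
    -- Any point of the fibre serves here: separated poles would make `g` conical for `i x`.
    refine ⟨x, rfl, fun g xm xp hg => ⟨?_, hg.ne⟩⟩
    by_contra hneq
    exact h ⟨g, _, _, hg.map hconv hi.continuous hi.equivariant hr hneq⟩
  · have hall : ∀ x ∈ i ⁻¹' {z}, IsAsymptoticTo x (laminationOf i) := by
      intro x hx g xm xp hg
      obtain ⟨y, hy, hyx⟩ := exists_ne_of_one_lt_encard h x
      exact ⟨hg.map_eq_of_ne hi.continuous hi.equivariant hyx (hy.trans hx.symm), hg.ne⟩
    obtain ⟨x, hx⟩ := hz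
    exact ⟨hall, hlift x hx (hall x hx)⟩
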